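/- For $n\ge 1$ let $P_a=\bigotimes_{k=1}^n i^{a_{x,k}a_{z,k}}X^{a_{x,k}}Z^{a_{z,k}}$, $a\in\mathbb{Z}_2^{2n}$, be the $n$-qubit Pauli operators. A Pauli channel with error rates $q$ (a probability distribution on $\mathbb{Z}_2^{2n}$) is $\Lambda(\rho)=\sum_a q_aP_a\rho P_a$; its Pauli eigenvalues are $\lambda_b=\sum_a q_a(-1)^{\langle a,b\rangle}$, where $\langle a,b\rangle=\sum_k(a_{x,k}b_{z,k}+a_{z,k}b_{x,k})\bmod 2$. A protocol without quantum memory with $T$ measurements runs $T$ rounds. In each round it prepares an $n$-qubit state $\rho$, queries the unknown channel $\Lambda$ some number $M\ge1$ of times, interleaved with data-processing channels (completely positive trace-preserving maps on the same $n$ qubits), so as to obtain $\Lambda(\mathcal{C}_{M-1}(\Lambda(\cdots\mathcal{C}_1(\Lambda(\rho))\cdots)))$, and measures all $n$ qubits of this state with a finite POVM $\{F_s\}$, which gives outcome $s$ with probability $\operatorname{Tr}(F_s\,\cdot)$. The number $M$, the state, the channels and the POVM may depend on all earlier outcomes (adaptivity), and discrete classical randomness may be used. After the last round the protocol outputs,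 as a function of its randomness and the outcomes, estimates $(\hat\lambda_b)_b$. It estimates all Pauli eigenvalues to error $\epsilon$ with probability at least $p$ if, for every Pauli channel $\Lambda$, with probability at least $p$ we have $|\hat\lambda_b-\lambda_b|<\epsilon$ for all $b$. Theorem 3.1. For every constant $p>1/2$ there is a constant $c>0$, depending only on $p$, such that for all $n\ge1$, all $0<\epsilon\le1$ and all $T$: any protocol without quantum memory, even adaptive and concatenating, that makes $T$ measurements and estimates all Pauli eigenvalues of an unknown $n$-qubit Pauli channel to error $\epsilon$ with probability at least $p$ satisfies $T\ge c\,2^n/\epsilon^2$. -/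

import Mathlib

namespace PauliLearning

open scoped ComplexOrder

/-- Basis labels of the `n`-qubit Hilbert space. -/
abbrev Basis (n : ℕ) : Type := Fin n → Fin 2

/-- Linear operators on the `n`-qubit Hilbert space, as `2^n × 2^n` complex matrices. -/
abbrev Op (n : ℕ) : Type := Matrix (Basis n) (Basis n) ℂ

/-- Labels of the `n`-qubit Pauli operators, i.e. elements of `(ℤ/2)^(2n)`. The `k`-th entry is
the pair of bits `(a_{x,k}, a_{z,k})`. -/
abbrev PauliIndex (n : ℕ) : Type := Fin n → ZMod 2 × ZMod 2

/-- The single-qubit Pauli operator `i^(xz) X^x Z^z`. -/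
noncomputable def pauli1 (a : ZMod 2 × ZMod 2) : Matrix (Fin 2) (Fin 2) ℂ :=
  Complex.I ^ (a.1.val * a.2.val) •
    ((!![0, 1; 1, 0] : Matrix (Fin 2) (Fin 2) ℂ) ^ a.1.val *
      (!![1, 0; 0, -1] : Matrix (Fin 2) (Fin 2) ℂ) ^ a.2.val)

/-- The `n`-qubit Pauli operator `P_a`, the tensor product of single-qubit Pauli operators. -/
noncomputable def pauli {n : ℕ} (a : PauliIndex n) : Op n :=
  Matrix.of fun s t => ∏ k, pauli1 (a k) (s k) (t k)

/-- The symplectic inner product on `(ℤ/2)^(2n)`. -/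
def symp {n : ℕ} (a b : PauliIndex n) : ZMod 2 :=
  ∑ k, ((a k).1 * (b k).2 + (a k).2 * (b k).1)

/-- The Pauli channel `ρ ↦ ∑ a, q_a P_a ρ P_a` with Pauli error rates `q`. -/
noncomputable def pauliChannel {n : ℕ} (q : PauliIndex n → ℝ) (ρ : Op n) : Op n :=
  ∑ a, (q a : ℂ) • (pauli a * ρ * pauli a)

/-- The Pauli eigenvalue `λ_b = ∑ a, q_a (-1)^⟨a,b⟩` of the Pauli channel with error rates `q`. -/
noncomputable def pauliEigenvalue {n : ℕ} (q : PauliIndex n → ℝ) (b : PauliIndex n) : ℝ :=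
  ∑ a, q a * (-1) ^ (symp a b).val

/-- An `n`-qubit state (density matrix). -/
structure State (n : ℕ) where
  mat : Op n
  posSemidef : mat.PosSemidef
  trace_eq_one : mat.trace = 1

/-- The map `id_k ⊗ Φ` on operators on `ℂ^k ⊗ (ℂ^2)^{⊗ n}`: apply `Φ` to each of the
`k × k` blocks. -/
def ampliation {n : ℕ} (k : ℕ) (Φ : Op n →ₗ[ℂ] Op n)
    (X : Matrix (Fin k × Basis n) (Fin k × Basis n) ℂ) :
    Matrix (Fin k × Basis n) (Fin k × Basis n) ℂ :=
  Matrix.of fun i j => Φ (Matrix.of fun s t => X (i.1, s) (j.1, t)) i.2 j.2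

/-- An `n`-qubit quantum channel: a completely positive trace-preserving linear map. -/
structure Channel (n : ℕ) where
  map : Op n →ₗ[ℂ] Op n
  completelyPositive : ∀ (k : ℕ) (X : Matrix (Fin k × Basis n) (Fin k × Basis n) ℂ),
    X.PosSemidef → (ampliation k map X).PosSemidef
  tracePreserving : ∀ X : Op n, (map X).trace = X.trace

/-- An `n`-qubit POVM with finitely many outcomes. -/
structure POVM (n : ℕ) where
  outcomes : ℕ
  elt : Fin outcomes → Op n
  posSemidef : ∀ s, (elt s).PosSemidef
  sum_eq_one : ∑ s, elt s = 1

/-- One round of a concatenating protocol without quantum memory: an `n`-qubit input state, the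
data-processing channels `C_1, …, C_{M-1}` on the same `n` qubits that are interleaved with
`M ≥ 1` queries to the unknown channel, and a final POVM on these `n` qubits. The number `M - 1`
is the length of the list, and is arbitrary. -/
structure Round (n : ℕ) where
  input : State n
  processing : List (Channel n)
  povm : POVM n

/-- The state `Λ(C_{M-1}(Λ(⋯ Λ(C_1(Λ(ρ))) ⋯)))` that is measured at the end of a round. -/
def Round.output {n : ℕ} (r : Round n) (Λ : Op n → Op n) : Op n :=
  r.processing.foldl (fun σ C => Λ (C.map σ)) (Λ r.input.mat)

/-- The probability `Tr(F_s ρ_out)` of outcome `s` in a round. -/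
noncomputable def Round.outcomeProb {n : ℕ} (r : Round n) (Λ : Op n → Op n)
    (s : Fin r.povm.outcomes) : ℝ :=
  ((r.povm.elt s * r.output Λ).trace).re

/-- Deterministic adaptive protocols without quantum memory that make exactly `T` measurements,
as learning trees. At each internal node a round is performed, which may depend on all earlier
outcomes, and its outcome selects the child; each leaf outputs estimates of all eigenvalues. -/
inductive LearningTree (n : ℕ) : ℕ → Type
  | leaf (estimate : PauliIndex n → ℝ) : LearningTree n 0
  | node {T : ℕ} (r : Round n) (next : Fin r.povm.outcomes → LearningTree n T) :
      LearningTree n (T + 1)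

open Classical in
/-- The probability that the vector of estimates output by the learning tree lies in `E`, if the
unknown channel is `Λ`: the sum, over the leaves with output in `E`, of the products of the outcome
probabilities along the path to the leaf. -/
noncomputable def LearningTree.prob {n : ℕ} (Λ : Op n → Op n) (E : Set (PauliIndex n → ℝ)) :
    {T : ℕ} → LearningTree n T → ℝ
  | _, .leaf estimate => if estimate ∈ E then 1 else 0
  | _, .node r next => ∑ s, r.outcomeProb Λ s * (next s).prob Λ E

/-- Adaptive, concatenating protocols without quantum memory that make `T` measurements: learning
trees, possibly chosen at random by means of classical randomness. -/
abbrev Protocol (n T : ℕ) : Type := PMF (LearningTree n T)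

/-- The probability that the estimates output by the protocol lie in `E`, if the unknown channel
is `Λ`. -/
noncomputable def Protocol.prob {n T : ℕ} (A : Protocol n T) (Λ : Op n → Op n)
    (E : Set (PauliIndex n → ℝ)) : ℝ :=
  ∑' t, (A t).toReal * t.prob Λ E

/-- The protocol solves Pauli eigenvalue estimation to error `ε` with probability at least `p`:
for each Pauli channel, with probability at least `p` all estimates have error less than `ε`. -/
def Protocol.Solves {n T : ℕ} (A : Protocol n T) (ε p : ℝ) : Prop :=
  ∀ q ∈ stdSimplex ℝ (PauliIndex n),
    p ≤ Protocol.prob A (pauliChannel q) {est | ∀ b, |est b - pauliEigenvalue q b| < ε}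

end PauliLearning

namespace PauliLearning

open scoped ComplexOrder
open Matrix

/-! The completely depolarizing channel has to be told apart from channels with one hidden spike,
whose only nonvanishing nontrivial eigenvalue is `λ_a = ±ε`. A spiked channel sends `ρ` to `(tr ρ •
1 + δ tr(P_a ρ) P_a) / 2^n`. Interleaved processing does not help: the measured operator is still
the image of some state under the last query (`exists_output_eq`), so relative to depolarizing noise
an outcome `F` has likelihood ratio `1 + x_a`, where `x_a = t_a tr(P_a F) / tr F` and `|t_a| ≤ ε`.
Parseval for Paulis, with `tr F² ≤ (tr F)²`, bounds the second moments of the `x_a`, summed over all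
`4^n` positions, by `ε² 2^n` (`exists_likelihood_ratio`): one round reveals about `ε² / 2^n` about a
typical spike.

Adaptivity is handled by following the likelihood ratio `y` down the tree. The chi-square potential
`(1 - y)²` would have increments that scale with `y²`. A triangular-discrimination potential
dominates `|1 - y|`, and its mean grows by at most `2/α` times the second moment of `x`, whatever
`y` is (`potential_mul_le`). Induction on the tree gives `sum_prob_sub_prob_le`.

A correct protocol accepts the spikes `ε` and `-ε` at `a` on disjoint events, each of probability at
least `p`. Under depolarizing noise their probabilities add up to at most `1`, so the gaps for the
two signs sum to at least `2p - 1` for every `a ≠ 0`. Comparing with the upper bound forces `T` to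
be of order `2^n / ε²`. -/

/-! ### Single-qubit Pauli identities. -/

lemma zmod_two_sq_cases (a : ZMod 2 × ZMod 2) :
    a = (0, 0) ∨ a = (0, 1) ∨ a = (1, 0) ∨ a = (1, 1) := by
  revert a; decide

lemma pauli1_id : pauli1 (0, 0) = 1 := by
  simp [pauli1]

lemma pauli1_Z : pauli1 (0, 1) = !![1, 0; 0, -1] := by
  simp [pauli1, ZMod.val_one]

lemma pauli1_X : pauli1 (1, 0) = !![0, 1; 1, 0] := by
  simp [pauli1, ZMod.val_one]

lemma pauli1_Y : pauli1 (1, 1) = !![0, -Complex.I; Complex.I, 0] := by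
  simp [pauli1, ZMod.val_one]

/-- The local factor of the symplectic inner product. -/
def symp1 (a b : ZMod 2 × ZMod 2) : ZMod 2 := a.1 * b.2 + a.2 * b.1

lemma neg_one_pow_zmod_add (R : Type*) [Ring R] (x y : ZMod 2) :
    (-1 : R) ^ (x + y).val = (-1) ^ x.val * (-1) ^ y.val := by
  rw [← pow_add, neg_one_pow_eq_pow_mod_two, neg_one_pow_eq_pow_mod_two (x.val + y.val),
    ZMod.val_add, Nat.mod_mod]

lemma neg_one_pow_zmod_sum (R : Type*) [CommRing R] {ι : Type*} (s : Finset ι) (f : ι → ZMod 2) :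
    (-1 : R) ^ (∑ i ∈ s, f i).val = ∏ i ∈ s, (-1) ^ (f i).val := by
  classical
  induction s using Finset.induction_on with
  | empty => simp
  | insert i s hi ih => rw [Finset.sum_insert hi, neg_one_pow_zmod_add, ih, Finset.prod_insert hi]

lemma neg_one_pow_symp (R : Type*) [CommRing R] {n : ℕ} (a b : PauliIndex n) :
    (-1 : R) ^ (symp a b).val = ∏ k, (-1) ^ (symp1 (a k) (b k)).val :=
  neg_one_pow_zmod_sum R _ _

lemma symp_comm {n : ℕ} (a b : PauliIndex n) : symp a b = symp b a := by
  unfold symp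
  exact Finset.sum_congr rfl fun k _ => by ring

lemma sum_zmod_two_sq {M : Type*} [AddCommMonoid M] (f : ZMod 2 × ZMod 2 → M) :
    ∑ b, f b = f (0, 0) + f (0, 1) + (f (1, 0) + f (1, 1)) := by
  rw [Fintype.sum_prod_type]
  rw [show (Finset.univ : Finset (ZMod 2)) = {0, 1} from rfl]
  simp

lemma sum_prod_pi {ι κ R : Type*} [Fintype ι] [DecidableEq ι] [Fintype κ] [CommSemiring R]
    (f : ι → κ → R) : ∑ b : ι → κ, ∏ k, f k (b k) = ∏ k, ∑ j, f k j :=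
  (Fintype.prod_sum f).symm

/-- Finite check on entries. Both sides are multiplicative over qubits, so this is all that the
`n`-qubit `twirl` needs. -/
lemma twirl1 (a : ZMod 2 × ZMod 2) (s u v t : Fin 2) :
    ∑ b, (-1 : ℂ) ^ (symp1 a b).val * (pauli1 b s u * pauli1 b v t) =
      2 * (pauli1 a s t * pauli1 a v u) := by
  rw [sum_zmod_two_sq, pauli1_id, pauli1_Z, pauli1_X, pauli1_Y]
  have h2 : ZMod.val (2 : ZMod 2) = 0 := rfl
  rcases zmod_two_sq_cases a with rfl | rfl | rfl | rfl <;>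
  fin_cases s <;> fin_cases u <;> fin_cases v <;> fin_cases t <;>
  norm_num [symp1, h2, ZMod.val_one, pauli1_id, pauli1_Z, pauli1_X, pauli1_Y]

lemma completeness1 (s t v u : Fin 2) :
    ∑ a, pauli1 a s t * pauli1 a v u = 2 * if s = u ∧ t = v then 1 else 0 := by
  rw [sum_zmod_two_sq, pauli1_id, pauli1_Z, pauli1_X, pauli1_Y]
  fin_cases s <;> fin_cases u <;> fin_cases v <;> fin_cases t <;> norm_num

lemma sum_character1 (a : ZMod 2 × ZMod 2) (ha : a ≠ 0) :
    ∑ b, (-1 : ℝ) ^ (symp1 a b).val = 0 := by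
  rw [sum_zmod_two_sq]
  have h2 : ZMod.val (2 : ZMod 2) = 0 := rfl
  rcases zmod_two_sq_cases a with rfl | rfl | rfl | rfl
  · exact absurd rfl ha
  all_goals norm_num [symp1, h2, ZMod.val_one]

lemma pauli1_mul_self (a : ZMod 2 × ZMod 2) : pauli1 a * pauli1 a = 1 := by
  rcases zmod_two_sq_cases a with rfl | rfl | rfl | rfl <;> ext i j <;>
  fin_cases i <;> fin_cases j <;>
  simp [pauli1_id, pauli1_Z, pauli1_X, pauli1_Y]

lemma star_pauli1 (a : ZMod 2 × ZMod 2) (s t : Fin 2) : star (pauli1 a s t) = pauli1 a t s := by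
  rcases zmod_two_sq_cases a with rfl | rfl | rfl | rfl <;> fin_cases s <;> fin_cases t <;>
  simp [pauli1_id, pauli1_Z, pauli1_X, pauli1_Y]

lemma trace_pauli1 (a : ZMod 2 × ZMod 2) (ha : a ≠ 0) : ∑ s, pauli1 a s s = 0 := by
  rcases zmod_two_sq_cases a with rfl | rfl | rfl | rfl
  · exact absurd rfl ha
  all_goals simp [pauli1_Z, pauli1_X, pauli1_Y]

/-! ### Pauli operators on `n` qubits: characters, twirling, completeness. -/

variable {n : ℕ}

lemma card_pauliIndex : Fintype.card (PauliIndex n) = 4 ^ n := by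
  simp

lemma pauli_apply (a : PauliIndex n) (s t : Basis n) :
    pauli a s t = ∏ k, pauli1 (a k) (s k) (t k) := rfl

lemma pauli_zero : pauli (0 : PauliIndex n) = 1 := by
  ext s t
  rw [pauli_apply, Matrix.one_apply]
  have h : ∀ k, pauli1 ((0 : PauliIndex n) k) = 1 := fun k => pauli1_id
  simp only [h, Matrix.one_apply]
  split_ifs with hst
  · subst hst; simp
  · obtain ⟨k, hk⟩ := Function.ne_iff.mp hst
    exact Finset.prod_eq_zero (Finset.mem_univ k) (if_neg hk)

lemma pauli_mul_self (a : PauliIndex n) : pauli a * pauli a = 1 := by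
  rw [← pauli_zero]
  ext s t
  simp only [Matrix.mul_apply, pauli_apply, ← Finset.prod_mul_distrib]
  rw [sum_prod_pi (fun k j => pauli1 (a k) (s k) j * pauli1 (a k) j (t k))]
  refine Finset.prod_congr rfl fun k _ => ?_
  rw [← Matrix.mul_apply, pauli1_mul_self]
  exact (congrFun₂ pauli1_id _ _).symm

lemma pauli_isHermitian (a : PauliIndex n) : (pauli a).IsHermitian := by
  ext s t
  rw [Matrix.conjTranspose_apply, pauli_apply, pauli_apply, star_prod]
  exact Finset.prod_congr rfl fun k _ => star_pauli1 _ _ _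

lemma trace_pauli (a : PauliIndex n) (ha : a ≠ 0) : (pauli a).trace = 0 := by
  simp only [Matrix.trace, Matrix.diag_apply, pauli_apply]
  rw [sum_prod_pi (fun k j => pauli1 (a k) j j)]
  obtain ⟨k, hk⟩ := Function.ne_iff.mp ha
  exact Finset.prod_eq_zero (Finset.mem_univ k) (trace_pauli1 _ hk)

lemma sum_character (a : PauliIndex n) (ha : a ≠ 0) :
    ∑ b, (-1 : ℝ) ^ (symp a b).val = 0 := by
  simp only [neg_one_pow_symp]
  rw [sum_prod_pi (fun k j => (-1 : ℝ) ^ (symp1 (a k) j).val)]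
  obtain ⟨k, hk⟩ := Function.ne_iff.mp ha
  exact Finset.prod_eq_zero (Finset.mem_univ k) (sum_character1 _ hk)

lemma twirl_apply (a : PauliIndex n) (s u v t : Basis n) :
    ∑ b, (-1 : ℂ) ^ (symp a b).val * (pauli b s u * pauli b v t) =
      2 ^ n * (pauli a s t * pauli a v u) := by
  simp only [neg_one_pow_symp, pauli_apply, ← Finset.prod_mul_distrib]
  rw [sum_prod_pi (fun k j => (-1 : ℂ) ^ (symp1 (a k) j).val *
    (pauli1 j (s k) (u k) * pauli1 j (v k) (t k)))]
  simp only [twirl1, Finset.prod_mul_distrib]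
  simp

lemma completeness_apply (s t v u : Basis n) :
    ∑ a, pauli a s t * pauli a v u = 2 ^ n * if s = u ∧ t = v then 1 else 0 := by
  simp only [pauli_apply, ← Finset.prod_mul_distrib]
  rw [sum_prod_pi (fun k j => pauli1 j (s k) (t k) * pauli1 j (v k) (u k))]
  simp only [completeness1, Finset.prod_mul_distrib]
  congr 1
  · simp
  · split_ifs with h
    · simp [h.1, h.2]
    · rw [not_and_or, ← ne_eq, ← ne_eq, Function.ne_iff, Function.ne_iff] at h
      rcases h with ⟨k, hk⟩ | ⟨k, hk⟩
      · exact Finset.prod_eq_zero (Finset.mem_univ k) (if_neg fun h => hk h.1)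
      · exact Finset.prod_eq_zero (Finset.mem_univ k) (if_neg fun h => hk h.2)

lemma twirl (a : PauliIndex n) (ρ : Op n) :
    ∑ b, (-1 : ℂ) ^ (symp a b).val • (pauli b * ρ * pauli b) =
      (2 ^ n * (pauli a * ρ).trace) • pauli a := by
  ext s t
  simp only [Matrix.sum_apply, Matrix.smul_apply, Matrix.mul_apply, Matrix.trace,
    Matrix.diag_apply, smul_eq_mul, Finset.sum_mul, Finset.mul_sum]
  calc ∑ b, ∑ v, ∑ u, (-1 : ℂ) ^ (symp a b).val * (pauli b s u * ρ u v * pauli b v t)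
      = ∑ v, ∑ u, ∑ b, (-1 : ℂ) ^ (symp a b).val * (pauli b s u * ρ u v * pauli b v t) := by
        rw [Finset.sum_comm]
        exact Finset.sum_congr rfl fun v _ => Finset.sum_comm
    _ = ∑ v, ∑ u, ρ u v * ∑ b, (-1 : ℂ) ^ (symp a b).val * (pauli b s u * pauli b v t) := by
        simp only [Finset.mul_sum]
        refine Finset.sum_congr rfl fun v _ => Finset.sum_congr rfl fun u _ =>
          Finset.sum_congr rfl fun b _ => by ring
    _ = _ := by
        simp only [twirl_apply]
        refine Finset.sum_congr rfl fun v _ => Finset.sum_congr rfl fun u _ => by ring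

/-- Parseval's identity for the Pauli basis, from the completeness relation. -/
lemma sum_trace_mul_pauli_sq (F : Op n) :
    ∑ a, (F * pauli a).trace ^ 2 = 2 ^ n * (F * F).trace := by
  have h : ∀ a : PauliIndex n, (F * pauli a).trace ^ 2 =
      ∑ u, ∑ s, ∑ t, ∑ v, F u s * F t v * (pauli a s u * pauli a v t) := by
    intro a
    simp only [sq, Matrix.trace, Matrix.diag_apply, Matrix.mul_apply, Finset.sum_mul]
    simp only [Finset.mul_sum]
    refine Finset.sum_congr rfl fun u _ => Finset.sum_congr rfl fun s _ =>
      Finset.sum_congr rfl fun t _ => Finset.sum_congr rfl fun v _ => by ring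
  simp only [h]
  rw [Finset.sum_comm]
  simp only [Matrix.trace, Matrix.diag_apply, Matrix.mul_apply, Finset.mul_sum]
  refine Finset.sum_congr rfl fun u _ => ?_
  rw [Finset.sum_comm]
  refine Finset.sum_congr rfl fun s _ => ?_
  rw [Finset.sum_comm]
  rw [Finset.sum_eq_single_of_mem s (Finset.mem_univ s)]
  · rw [Finset.sum_comm, Finset.sum_eq_single_of_mem u (Finset.mem_univ u)]
    · rw [← Finset.mul_sum, completeness_apply]
      simp; ring
    · intro v _ hv
      rw [← Finset.mul_sum, completeness_apply, if_neg fun h => hv h.2.symm]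
      simp
  · intro t _ ht
    rw [Finset.sum_comm]
    refine Finset.sum_eq_zero fun v _ => ?_
    rw [← Finset.mul_sum, completeness_apply, if_neg fun h => ht h.1.symm]
    simp

/-! ### Trace inequalities for positive semidefinite operators. -/

lemma trace_mul_self_le {ι : Type*} [Fintype ι] {F : Matrix ι ι ℂ}
    (hF : F.PosSemidef) : (F * F).trace ≤ F.trace ^ 2 := by
  classical
  simp only [sq, Matrix.trace, Matrix.diag_apply, Matrix.mul_apply, Finset.sum_mul_sum]
  refine Finset.sum_le_sum fun i _ => Finset.sum_le_sum fun j _ => ?_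
  -- The 2 × 2 minors give `F i j * F j i ≤ F i i * F j j`; repeated indices `i = j` are harmless.
  have h := (hF.submatrix ![i, j]).det_nonneg
  rw [Matrix.det_fin_two] at h
  simpa using h

/-- `1 + c P_a` is Hermitian and squares to twice itself, so conjugating `X` by it yields a positive
operator of trace `2 tr((1 + c P_a) X)`. The cases `c = ±1` bound `tr(P_a X)` from both sides. -/
lemma trace_pauli_mul_self_le (a : PauliIndex n) {X : Op n} (hX : X.PosSemidef) (c : ℂ)
    (hc : star c = c) (hc2 : c * c = 1) : 0 ≤ X.trace + c * (pauli a * X).trace := by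
  have h := (hX.conjTranspose_mul_mul_same (1 + c • pauli a)).trace_nonneg
  have hH : (1 + c • pauli a)ᴴ = 1 + c • pauli a := by
    rw [conjTranspose_add, conjTranspose_smul, pauli_isHermitian, hc, conjTranspose_one]
  have hs : (1 + c • pauli a) * (1 + c • pauli a) = (2 : ℂ) • (1 + c • pauli a) := by
    simp only [mul_add, add_mul, one_mul, mul_one, smul_mul_assoc, mul_smul_comm,
      pauli_mul_self]
    rw [smul_add, smul_smul, hc2]
    module
  rw [hH, trace_mul_comm, ← mul_assoc, hs, smul_mul_assoc, trace_smul, add_mul, one_mul,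
    smul_mul_assoc, trace_add, trace_smul, smul_eq_mul, smul_eq_mul] at h
  have h2 : (0 : ℂ) ≤ 2⁻¹ := by rw [Complex.nonneg_iff]; norm_num
  simpa using mul_nonneg h2 h

lemma trace_im_eq_zero {X : Op n} (hX : X.PosSemidef) : X.trace.im = 0 :=
  (Complex.nonneg_iff.mp hX.trace_nonneg).2.symm

lemma trace_re_nonneg {X : Op n} (hX : X.PosSemidef) : 0 ≤ X.trace.re :=
  (Complex.nonneg_iff.mp hX.trace_nonneg).1

lemma ofReal_trace_re {X : Op n} (hX : X.PosSemidef) : (X.trace.re : ℂ) = X.trace :=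
  Complex.ext rfl (trace_im_eq_zero hX).symm

lemma trace_pauli_mul_im (a : PauliIndex n) {X : Op n} (hX : X.PosSemidef) :
    (pauli a * X).trace.im = 0 := by
  have h := (Complex.nonneg_iff.mp (trace_pauli_mul_self_le a hX 1 (by simp) (by simp))).2
  simpa [trace_im_eq_zero hX] using h.symm

lemma ofReal_trace_pauli_mul_re (a : PauliIndex n) {X : Op n} (hX : X.PosSemidef) :
    ((pauli a * X).trace.re : ℂ) = (pauli a * X).trace :=
  Complex.ext rfl (trace_pauli_mul_im a hX).symm

lemma abs_trace_pauli_mul_re_le (a : PauliIndex n) {X : Op n} (hX : X.PosSemidef) :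
    |(pauli a * X).trace.re| ≤ X.trace.re := by
  have h1 := (Complex.nonneg_iff.mp (trace_pauli_mul_self_le a hX 1 (by simp) (by simp))).1
  have h2 := (Complex.nonneg_iff.mp (trace_pauli_mul_self_le a hX (-1) (by simp) (by simp))).1
  simp only [one_mul, Complex.add_re, neg_mul, Complex.neg_re] at h1 h2
  rw [abs_le]
  constructor <;> linarith

lemma sum_trace_pauli_mul_re_sq_le {F : Op n} (hF : F.PosSemidef) :
    ∑ a, (pauli a * F).trace.re ^ 2 ≤ 2 ^ n * F.trace.re ^ 2 := by
  have h := sum_trace_mul_pauli_sq F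
  have h' : ((∑ a, (pauli a * F).trace.re ^ 2 : ℝ) : ℂ) = 2 ^ n * (F * F).trace := by
    rw [← h]
    push_cast
    refine Finset.sum_congr rfl fun a _ => ?_
    rw [ofReal_trace_pauli_mul_re a hF, trace_mul_comm]
  have h2 : ((∑ a, (pauli a * F).trace.re ^ 2 : ℝ) : ℂ) ≤ ((2 ^ n * F.trace.re ^ 2 : ℝ) : ℂ) := by
    rw [h']
    push_cast
    rw [ofReal_trace_re hF]
    exact mul_le_mul_of_nonneg_left (trace_mul_self_le hF) (by positivity)
  exact_mod_cast h2

/-! ### Channels and concatenated queries. -/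

lemma posSemidef_channel_map (C : Channel n) {X : Op n} (hX : X.PosSemidef) :
    (C.map X).PosSemidef := by
  have h := C.completelyPositive 1 (X.submatrix Prod.snd Prod.snd) (hX.submatrix _)
  exact h.submatrix fun s : Basis n => ((0 : Fin 1), s)

lemma posSemidef_pauliChannel {q : PauliIndex n → ℝ} (hq : ∀ a, 0 ≤ q a) {X : Op n}
    (hX : X.PosSemidef) : (pauliChannel q X).PosSemidef := by
  refine posSemidef_sum _ fun a _ => ?_
  have h := hX.mul_mul_conjTranspose_same (pauli a)
  rw [pauli_isHermitian] at h
  exact h.smul (by exact_mod_cast hq a)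

lemma trace_pauliChannel {q : PauliIndex n → ℝ} (hq : ∑ a, q a = 1) (X : Op n) :
    (pauliChannel q X).trace = X.trace := by
  have h : ∀ a : PauliIndex n, (pauli a * X * pauli a).trace = X.trace := fun a => by
    rw [trace_mul_comm, ← mul_assoc, pauli_mul_self, one_mul]
  simp only [pauliChannel, trace_sum, trace_smul, h, ← Finset.sum_smul]
  rw [← Complex.ofReal_sum, hq]
  simp

/-- The state measured at the end of a round is the image of some state under the unknown
channel. -/
lemma exists_output_eq (r : Round n) {Λ : Op n → Op n}
    (hpos : ∀ X : Op n, X.PosSemidef → (Λ X).PosSemidef) (htr : ∀ X : Op n, (Λ X).trace = X.trace) :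
    ∃ ρ : Op n, ρ.PosSemidef ∧ ρ.trace = 1 ∧ r.output Λ = Λ ρ := by
  have key : ∀ (l : List (Channel n)) (ρ : Op n), ρ.PosSemidef → ρ.trace = 1 →
      ∃ ρ' : Op n, ρ'.PosSemidef ∧ ρ'.trace = 1 ∧
        l.foldl (fun σ C => Λ (C.map σ)) (Λ ρ) = Λ ρ' := by
    intro l
    induction l with
    | nil => exact fun ρ h1 h2 => ⟨ρ, h1, h2, rfl⟩
    | cons C l ih =>
      intro ρ h1 h2
      exact ih (C.map (Λ ρ)) (posSemidef_channel_map C (hpos _ h1))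
        (by rw [C.tracePreserving, htr, h2])
  exact key r.processing r.input.mat r.input.posSemidef r.input.trace_eq_one

/-! ### Spiked Pauli channels. -/

/-- The error rates of the Pauli channel all of whose nontrivial eigenvalues vanish, except for
`λ_a = δ`. -/
noncomputable def spikeRates (a : PauliIndex n) (δ : ℝ) (b : PauliIndex n) : ℝ :=
  (1 + δ * (-1) ^ (symp a b).val) / 4 ^ n

lemma spikeRates_nonneg (a : PauliIndex n) {δ : ℝ} (hδ : |δ| ≤ 1) (b : PauliIndex n) :
    0 ≤ spikeRates a δ b := by
  refine div_nonneg ?_ (by positivity)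
  obtain ⟨h1, h2⟩ := abs_le.mp hδ
  rcases neg_one_pow_eq_or ℝ (symp a b).val with h | h <;> rw [h] <;> linarith

lemma sum_spikeRates {a : PauliIndex n} (ha : a ≠ 0) (δ : ℝ) : ∑ b, spikeRates a δ b = 1 := by
  simp only [spikeRates, ← Finset.sum_div, Finset.sum_add_distrib, ← Finset.mul_sum,
    sum_character a ha, Finset.sum_const, Finset.card_univ, card_pauliIndex]
  simp

lemma spikeRates_mem_stdSimplex {a : PauliIndex n} (ha : a ≠ 0) {δ : ℝ} (hδ : |δ| ≤ 1) :
    spikeRates a δ ∈ stdSimplex ℝ (PauliIndex n) :=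
  ⟨spikeRates_nonneg a hδ, sum_spikeRates ha δ⟩

lemma pauliEigenvalue_spikeRates {a : PauliIndex n} (ha : a ≠ 0) (δ : ℝ) :
    pauliEigenvalue (spikeRates a δ) a = δ := by
  have h : ∀ b, spikeRates a δ b * (-1) ^ (symp b a).val =
      ((-1) ^ (symp a b).val + δ) / 4 ^ n := by
    intro b
    rw [symp_comm b a, spikeRates]
    rcases neg_one_pow_eq_or ℝ (symp a b).val with h | h <;> rw [h] <;> ring
  simp only [pauliEigenvalue, h, ← Finset.sum_div, Finset.sum_add_distrib,
    sum_character a ha, Finset.sum_const, Finset.card_univ, card_pauliIndex]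
  simp

lemma pauliChannel_spikeRates (a : PauliIndex n) (δ : ℝ) (ρ : Op n) :
    pauliChannel (spikeRates a δ) ρ =
      ((2 : ℂ) ^ n)⁻¹ • (ρ.trace • 1 + (δ * (pauli a * ρ).trace) • pauli a) := by
  have h0 : ∑ b : PauliIndex n, pauli b * ρ * pauli b = (2 ^ n * ρ.trace) • (1 : Op n) := by
    have h := twirl 0 ρ
    simpa [symp, pauli_zero] using h
  have h1 := twirl a ρ
  have h4 : (4 : ℂ) ^ n = 2 ^ n * 2 ^ n := by rw [← mul_pow]; norm_num
  have h2 : (2 : ℂ) ^ n ≠ 0 := by positivity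
  calc pauliChannel (spikeRates a δ) ρ
      = ((4 : ℂ) ^ n)⁻¹ • (∑ b : PauliIndex n, pauli b * ρ * pauli b +
          (δ : ℂ) • ∑ b, (-1 : ℂ) ^ (symp a b).val • (pauli b * ρ * pauli b)) := by
        rw [Finset.smul_sum, ← Finset.sum_add_distrib, Finset.smul_sum]
        refine Finset.sum_congr rfl fun b _ => ?_
        rw [spikeRates]
        push_cast
        rw [smul_smul, div_eq_inv_mul, mul_smul, add_smul, one_smul]
    _ = _ := by
        rw [h0, h1, h4, smul_add, smul_add, smul_smul, smul_smul, smul_smul, smul_smul]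
        congr 1
        · congr 1
          field_simp
        · rw [smul_smul]
          congr 1
          field_simp

/-! ### Likelihood ratios of a single round. -/

/-- The outcome probability of a round, if the unknown channel is completely depolarizing. -/
noncomputable def baseProb (r : Round n) (s : Fin r.povm.outcomes) : ℝ :=
  (r.povm.elt s).trace.re / 2 ^ n

lemma baseProb_nonneg (r : Round n) (s : Fin r.povm.outcomes) : 0 ≤ baseProb r s :=
  div_nonneg (trace_re_nonneg (r.povm.posSemidef s)) (by positivity)

lemma sum_trace_elt (r : Round n) : ∑ s, (r.povm.elt s).trace.re = 2 ^ n := by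
  rw [← Complex.re_sum, ← trace_sum, r.povm.sum_eq_one, trace_one]
  rw [← Complex.ofReal_natCast, Complex.ofReal_re]
  simp

lemma sum_baseProb (r : Round n) : ∑ s, baseProb r s = 1 := by
  simp only [baseProb, ← Finset.sum_div, sum_trace_elt]
  exact div_self (by positivity)

lemma sum_trace_pauli_mul_elt (r : Round n) {a : PauliIndex n} (ha : a ≠ 0) :
    ∑ s, (pauli a * r.povm.elt s).trace.re = 0 := by
  rw [← Complex.re_sum, ← trace_sum, ← Finset.mul_sum, r.povm.sum_eq_one, mul_one, trace_pauli a ha]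
  simp

lemma outcomeProb_spikeRates (r : Round n) {a : PauliIndex n} (ha : a ≠ 0) {δ : ℝ} (hδ : |δ| ≤ 1) :
    ∃ t : ℝ, |t| ≤ |δ| ∧ ∀ s, r.outcomeProb (pauliChannel (spikeRates a δ)) s =
      ((r.povm.elt s).trace.re + t * (pauli a * r.povm.elt s).trace.re) / 2 ^ n := by
  obtain ⟨ρ, hρ, hρ1, h⟩ := exists_output_eq r
    (fun X hX => posSemidef_pauliChannel (spikeRates_nonneg a hδ) hX)
    (trace_pauliChannel (sum_spikeRates ha δ))
  refine ⟨δ * (pauli a * ρ).trace.re, ?_, fun s => ?_⟩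
  · have h1 := abs_trace_pauli_mul_re_le a hρ
    rw [hρ1, Complex.one_re] at h1
    rw [abs_mul]
    exact mul_le_of_le_one_right (abs_nonneg _) h1
  · have hF := r.povm.posSemidef s
    rw [Round.outcomeProb, h, pauliChannel_spikeRates, hρ1, one_smul, mul_smul_comm, mul_add,
      mul_one, mul_smul_comm, trace_smul, trace_add, trace_smul,
      trace_mul_comm (r.povm.elt s) (pauli a),
      ← ofReal_trace_pauli_mul_re a hF, ← ofReal_trace_pauli_mul_re a hρ, ← ofReal_trace_re hF]
    simp only [smul_eq_mul]
    simp only [Complex.ofReal_re]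
    rw [← Complex.ofReal_re ((_ + _) / _)]
    congr 1
    push_cast
    ring

/-- The likelihood ratios of the outcomes of a round, relative to the completely depolarizing
channel. -/
lemma exists_likelihood_ratio (r : Round n) {ε : ℝ} (hε : ε ≤ 1)
    {δ : PauliIndex n → ℝ} (hδ : ∀ a, |δ a| ≤ ε) :
    ∃ x : PauliIndex n → Fin r.povm.outcomes → ℝ, (∀ a s, -1 ≤ x a s) ∧
      (∀ a, a ≠ 0 → ∀ s, r.outcomeProb (pauliChannel (spikeRates a (δ a))) s =
        baseProb r s * (1 + x a s)) ∧
      (∀ a, a ≠ 0 → ∑ s, baseProb r s * x a s = 0) ∧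
      ∑ a, ∑ s, baseProb r s * x a s ^ 2 ≤ ε ^ 2 * 2 ^ n := by
  have hε0 : 0 ≤ ε := (abs_nonneg _).trans (hδ 0)
  have ht : ∀ a : PauliIndex n, ∃ t : ℝ, |t| ≤ ε ∧ (a ≠ 0 → ∀ s,
      r.outcomeProb (pauliChannel (spikeRates a (δ a))) s =
      ((r.povm.elt s).trace.re + t * (pauli a * r.povm.elt s).trace.re) / 2 ^ n) := by
    intro a
    -- The rates at `a = 0` need not be normalized; `t = 0` makes this index contribute nothing to
    -- the sum over all `a`.
    by_cases ha : a = 0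
    · exact ⟨0, by simpa using hε0, fun h => absurd ha h⟩
    · obtain ⟨t, h1, h2⟩ := outcomeProb_spikeRates r ha ((hδ a).trans hε)
      exact ⟨t, h1.trans (hδ a), fun _ => h2⟩
  choose t ht1 ht2 using ht
  set f : Fin r.povm.outcomes → ℝ := fun s => (r.povm.elt s).trace.re with hf
  set g : PauliIndex n → Fin r.povm.outcomes → ℝ := fun a s => (pauli a * r.povm.elt s).trace.re
    with hg
  have hfg : ∀ a s, |g a s| ≤ f s := fun a s => abs_trace_pauli_mul_re_le a (r.povm.posSemidef s)
  have hf0 : ∀ s, 0 ≤ f s := fun s => trace_re_nonneg (r.povm.posSemidef s)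
  have hx : ∀ a s, f s * (t a * g a s / f s) = t a * g a s := by
    intro a s
    -- If `f s = 0`, then `|g a s| ≤ f s` forces `g a s = 0`, so the convention for division by zero
    -- is harmless.
    rcases eq_or_ne (f s) 0 with h | h
    · have h0 : g a s = 0 := by simpa [h] using hfg a s
      simp [h0]
    · field_simp
  refine ⟨fun a s => t a * g a s / f s, fun a s => ?_, fun a ha s => ?_, fun a ha => ?_, ?_⟩
  · have h : |t a * g a s / f s| ≤ 1 := by
      rw [abs_div, abs_mul, abs_of_nonneg (hf0 s)]
      refine div_le_one_of_le₀ ?_ (hf0 s)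
      exact (mul_le_of_le_one_left (abs_nonneg _) ((ht1 a).trans hε)).trans (hfg a s)
    exact (abs_le.mp h).1
  · rw [ht2 a ha s]
    change _ = f s / 2 ^ n * (1 + t a * g a s / f s)
    rw [show f s / 2 ^ n * (1 + t a * g a s / f s) =
      (f s + f s * (t a * g a s / f s)) / 2 ^ n by ring, hx]
  · have h : ∀ s, baseProb r s * (t a * g a s / f s) = t a / 2 ^ n * g a s := by
      intro s
      calc baseProb r s * (t a * g a s / f s) = f s * (t a * g a s / f s) / 2 ^ n := by
            change f s / 2 ^ n * _ = _
            ring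
        _ = _ := by rw [hx]; ring
    simp only [h, ← Finset.mul_sum]
    rw [sum_trace_pauli_mul_elt r ha, mul_zero]
  · rw [Finset.sum_comm]
    have h : ∀ s, ∑ a, baseProb r s * (t a * g a s / f s) ^ 2 ≤ ε ^ 2 * f s := by
      intro s
      rcases (hf0 s).eq_or_lt with h0 | h0
      · simp [← h0]
      calc ∑ a, baseProb r s * (t a * g a s / f s) ^ 2
          ≤ ∑ a, ε ^ 2 / (2 ^ n * f s) * g a s ^ 2 := by
            refine Finset.sum_le_sum fun a _ => ?_
            have hb : baseProb r s * (t a * g a s / f s) ^ 2 =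
                t a ^ 2 * (g a s ^ 2 / (2 ^ n * f s)) := by
              change f s / 2 ^ n * _ = _
              field_simp
            rw [hb, show ε ^ 2 / (2 ^ n * f s) * g a s ^ 2 =
              ε ^ 2 * (g a s ^ 2 / (2 ^ n * f s)) by ring]
            refine mul_le_mul_of_nonneg_right ?_ (by positivity)
            exact sq_le_sq' (abs_le.mp (ht1 a)).1 (abs_le.mp (ht1 a)).2
        _ ≤ ε ^ 2 / (2 ^ n * f s) * (2 ^ n * f s ^ 2) := by
            rw [← Finset.mul_sum]
            exact mul_le_mul_of_nonneg_left
              (sum_trace_pauli_mul_re_sq_le (r.povm.posSemidef s)) (by positivity)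
        _ = ε ^ 2 * f s := by field_simp
    calc _ ≤ ∑ s, ε ^ 2 * f s := Finset.sum_le_sum fun s _ => h s
      _ = ε ^ 2 * 2 ^ n := by rw [← Finset.mul_sum, sum_trace_elt]

/-! ### The potential function. -/

/-- The potential that controls the likelihood ratio process along a learning tree: up to a linear
term, the triangular discrimination. -/
noncomputable def potential (α y : ℝ) : ℝ := α / 2 * (1 + y) + (1 - y) ^ 2 / (1 + y) / (2 * α)

/-- AM-GM for the two summands of the potential, whose product is `(1 - y)² / 4`. -/
lemma abs_one_sub_le_potential {α y : ℝ} (hα : 0 < α) (hy : 0 ≤ y) :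
    |1 - y| ≤ potential α y := by
  have h1 : 0 < 1 + y := by linarith
  have h2 : potential α y - |1 - y| = (α * (1 + y) - |1 - y|) ^ 2 / (2 * α * (1 + y)) := by
    rw [potential, ← sq_abs (1 - y)]
    field_simp
    ring
  have h3 : 0 ≤ (α * (1 + y) - |1 - y|) ^ 2 / (2 * α * (1 + y)) := by positivity
  linarith

/-- The derivative of the potential, multiplied by `y`. -/
noncomputable def potentialSlope (α y : ℝ) : ℝ :=
  (α / 2 + (1 - 4 / (1 + y) ^ 2) / (2 * α)) * y

/-- Up to an affine function of `y` the potential is `2 / (α (1 + y))`, so the Taylor remainder is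
explicit (`key`). It is at most `2 / α * x ^ 2` uniformly in `y`, which makes the increments
additive along adaptive paths. -/
lemma potential_mul_le {α y x : ℝ} (hα : 0 < α) (hy : 0 ≤ y) (hx : -1 ≤ x) :
    potential α (y * (1 + x)) ≤ potential α y + potentialSlope α y * x + 2 / α * x ^ 2 := by
  have h1 : 0 < 1 + y := by linarith
  have h2 : 1 ≤ 1 + y * (1 + x) := by nlinarith [mul_nonneg hy (by linarith : 0 ≤ 1 + x)]
  have h3 : 0 < 1 + y * (1 + x) := by linarith
  have key : potential α (y * (1 + x)) = potential α y + potentialSlope α y * x +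
      2 / α * (x ^ 2 * (y ^ 2 / ((1 + y) ^ 2 * (1 + y * (1 + x))))) := by
    rw [potential, potential, potentialSlope]
    field_simp
    ring
  have hle : y ^ 2 / ((1 + y) ^ 2 * (1 + y * (1 + x))) ≤ 1 := by
    rw [div_le_one (by positivity)]
    nlinarith [mul_le_mul_of_nonneg_left h2 (sq_nonneg (1 + y))]
  rw [key]
  have := mul_le_of_le_one_right (sq_nonneg x) hle
  gcongr

/-! ### Induction along learning trees. -/

lemma LearningTree.prob_leaf_eq (Λ : Op n → Op n) (E : Set (PauliIndex n → ℝ))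
    (e : PauliIndex n → ℝ) :
    (LearningTree.leaf e).prob Λ E = E.indicator 1 e := by
  classical
  simp only [LearningTree.prob, Set.indicator_apply, Pi.one_apply]

/-- The outcome distribution of a learning tree for a spiked Pauli channel is close to the one for
the completely depolarizing channel `Λ₀`, on average over the position of the spike. -/
lemma sum_prob_sub_prob_le {ε : ℝ} (hε : ε ≤ 1) {α : ℝ} (hα : 0 < α)
    {δ : PauliIndex n → ℝ} (hδ : ∀ a, |δ a| ≤ ε) {Λ₀ : Op n → Op n}
    (hΛ₀ : ∀ (r : Round n) s, r.outcomeProb Λ₀ s = baseProb r s)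
    (E : PauliIndex n → Set (PauliIndex n → ℝ)) {T : ℕ} (t : LearningTree n T)
    (S : Finset (PauliIndex n)) (hS : ∀ a ∈ S, a ≠ 0)
    (y : PauliIndex n → ℝ) (hy : ∀ a, 0 ≤ y a) :
    ∑ a ∈ S, (y a * t.prob (pauliChannel (spikeRates a (δ a))) (E a) - t.prob Λ₀ (E a)) ≤
      ∑ a ∈ S, potential α (y a) + T * (2 / α * (ε ^ 2 * 2 ^ n)) := by
  -- `y a` is the likelihood ratio accumulated on the way to the current node; a child receives `y a
  -- * (1 + x a s)`.
  induction t generalizing y with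
  | leaf e =>
    simp only [LearningTree.prob_leaf_eq, Nat.cast_zero, zero_mul, add_zero]
    refine Finset.sum_le_sum fun a _ => ?_
    have h := abs_one_sub_le_potential hα (hy a)
    have h1 := neg_abs_le (1 - y a)
    by_cases he : e ∈ E a
    · simp only [Set.indicator_of_mem he, Pi.one_apply]
      linarith
    · simp only [Set.indicator_of_notMem he]
      linarith [abs_nonneg (1 - y a)]
  | @node T r next ih =>
    obtain ⟨x, hx1, hxp, hx0, hx2⟩ := exists_likelihood_ratio r hε hδ
    have hp := baseProb_nonneg r
    have hy' : ∀ s a, 0 ≤ y a * (1 + x a s) := fun s a =>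
      mul_nonneg (hy a) (by linarith [hx1 a s])
    have hvar : ∑ a ∈ S, ∑ s, baseProb r s * x a s ^ 2 ≤ ε ^ 2 * 2 ^ n :=
      (Finset.sum_le_sum_of_subset_of_nonneg (Finset.subset_univ S) fun a _ _ =>
        Finset.sum_nonneg fun s _ => mul_nonneg (hp s) (sq_nonneg _)).trans hx2
    calc ∑ a ∈ S, (y a * (LearningTree.node r next).prob (pauliChannel (spikeRates a (δ a))) (E a) -
          (LearningTree.node r next).prob Λ₀ (E a))
        = ∑ s, baseProb r s * ∑ a ∈ S, (y a * (1 + x a s) *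
            (next s).prob (pauliChannel (spikeRates a (δ a))) (E a) -
            (next s).prob Λ₀ (E a)) := by
          simp only [Finset.mul_sum]
          rw [Finset.sum_comm]
          refine Finset.sum_congr rfl fun a ha => ?_
          simp only [LearningTree.prob, hΛ₀, hxp a (hS a ha)]
          rw [Finset.mul_sum, ← Finset.sum_sub_distrib]
          exact Finset.sum_congr rfl fun s _ => by ring
      _ ≤ ∑ s, baseProb r s * (∑ a ∈ S, (potential α (y a) + potentialSlope α (y a) * x a s +
            2 / α * x a s ^ 2) + T * (2 / α * (ε ^ 2 * 2 ^ n))) := by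
          refine Finset.sum_le_sum fun s _ => mul_le_mul_of_nonneg_left ?_ (hp s)
          refine (ih s _ (hy' s)).trans (add_le_add ?_ le_rfl)
          exact Finset.sum_le_sum fun a _ => potential_mul_le hα (hy a) (hx1 a s)
      _ = ∑ a ∈ S, (potential α (y a) * ∑ s, baseProb r s +
            potentialSlope α (y a) * ∑ s, baseProb r s * x a s +
            2 / α * ∑ s, baseProb r s * x a s ^ 2) +
            (∑ s, baseProb r s) * (T * (2 / α * (ε ^ 2 * 2 ^ n))) := by
          simp only [mul_add, Finset.sum_add_distrib, Finset.mul_sum, Finset.sum_mul]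
          rw [Finset.sum_comm (s := S), Finset.sum_comm (s := S), Finset.sum_comm (s := S)]
          congr 1
          congr 1
          congr 1
          all_goals exact Finset.sum_congr rfl fun s _ => Finset.sum_congr rfl fun a _ => by ring
      _ = ∑ a ∈ S, potential α (y a) + 2 / α * (∑ a ∈ S, ∑ s, baseProb r s * x a s ^ 2) +
            T * (2 / α * (ε ^ 2 * 2 ^ n)) := by
          rw [sum_baseProb, one_mul, Finset.mul_sum, ← Finset.sum_add_distrib]
          congr 1
          exact Finset.sum_congr rfl fun a ha => by rw [hx0 a (hS a ha)]; ring
      _ ≤ ∑ a ∈ S, potential α (y a) + ((T + 1 : ℕ) : ℝ) * (2 / α * (ε ^ 2 * 2 ^ n)) := by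
          have := mul_le_mul_of_nonneg_left hvar (by positivity : 0 ≤ 2 / α)
          push_cast
          linarith

lemma LearningTree.prob_nonneg {Λ₀ : Op n → Op n}
    (hΛ₀ : ∀ (r : Round n) s, r.outcomeProb Λ₀ s = baseProb r s) (E : Set (PauliIndex n → ℝ))
    {T : ℕ} (t : LearningTree n T) : 0 ≤ t.prob Λ₀ E := by
  induction t with
  | leaf e => rw [LearningTree.prob_leaf_eq]; exact Set.indicator_nonneg (fun _ _ => zero_le_one) e
  | node r next ih =>
    simp only [LearningTree.prob, hΛ₀]
    exact Finset.sum_nonneg fun s _ => mul_nonneg (baseProb_nonneg r s) (ih s)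

lemma LearningTree.prob_add_prob_le_one {Λ₀ : Op n → Op n}
    (hΛ₀ : ∀ (r : Round n) s, r.outcomeProb Λ₀ s = baseProb r s) {E E' : Set (PauliIndex n → ℝ)}
    (hE : Disjoint E E') {T : ℕ} (t : LearningTree n T) :
    t.prob Λ₀ E + t.prob Λ₀ E' ≤ 1 := by
  induction t with
  | leaf e =>
    simp only [LearningTree.prob_leaf_eq]
    by_cases he : e ∈ E
    · simp [he, Set.disjoint_left.mp hE he]
    · simp only [Set.indicator_of_notMem he, zero_add]
      exact Set.indicator_apply_le' (fun _ => le_rfl) fun _ => zero_le_one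
  | node r next ih =>
    simp only [LearningTree.prob, hΛ₀]
    rw [← Finset.sum_add_distrib, ← sum_baseProb r]
    refine Finset.sum_le_sum fun s _ => ?_
    rw [← mul_add]
    exact mul_le_of_le_one_right (baseProb_nonneg r s) (ih s)

/-! ### Averaging over classical randomness. -/

lemma summable_toReal {β : Type*} (A : PMF β) : Summable fun t => (A t).toReal :=
  ENNReal.summable_toReal A.tsum_coe_ne_top

lemma tsum_toReal {β : Type*} (A : PMF β) : ∑' t, (A t).toReal = 1 := by
  rw [← ENNReal.tsum_toReal_eq A.apply_ne_top, A.tsum_coe, ENNReal.toReal_one]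

lemma summable_mul_prob_base {T : ℕ} (A : Protocol n T) {Λ₀ : Op n → Op n}
    (hΛ₀ : ∀ (r : Round n) s, r.outcomeProb Λ₀ s = baseProb r s) (E : Set (PauliIndex n → ℝ)) :
    Summable fun t => (A t).toReal * t.prob Λ₀ E := by
  refine Summable.of_nonneg_of_le
    (fun t => mul_nonneg ENNReal.toReal_nonneg (t.prob_nonneg hΛ₀ E)) (fun t => ?_)
    (summable_toReal A)
  refine mul_le_of_le_one_right ENNReal.toReal_nonneg ?_
  have := t.prob_add_prob_le_one hΛ₀ (Set.disjoint_empty E)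
  linarith [t.prob_nonneg hΛ₀ ∅]

lemma Protocol.prob_add_prob_le_one {T : ℕ} (A : Protocol n T) {Λ₀ : Op n → Op n}
    (hΛ₀ : ∀ (r : Round n) s, r.outcomeProb Λ₀ s = baseProb r s) {E E' : Set (PauliIndex n → ℝ)}
    (hE : Disjoint E E') : A.prob Λ₀ E + A.prob Λ₀ E' ≤ 1 := by
  have h1 := summable_mul_prob_base A hΛ₀ E
  have h2 := summable_mul_prob_base A hΛ₀ E'
  rw [Protocol.prob, Protocol.prob, ← h1.tsum_add h2, ← tsum_toReal A]
  refine (h1.add h2).tsum_le_tsum (fun t => ?_) (summable_toReal A)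
  rw [← mul_add]
  exact mul_le_of_le_one_right ENNReal.toReal_nonneg (t.prob_add_prob_le_one hΛ₀ hE)

lemma Protocol.sum_prob_sub_prob_le {ε : ℝ} (hε : ε ≤ 1) {α : ℝ} (hα : 0 < α)
    {δ : PauliIndex n → ℝ} (hδ : ∀ a, |δ a| ≤ ε) {Λ₀ : Op n → Op n}
    (hΛ₀ : ∀ (r : Round n) s, r.outcomeProb Λ₀ s = baseProb r s)
    (E : PauliIndex n → Set (PauliIndex n → ℝ)) {T : ℕ} (A : Protocol n T)
    (S : Finset (PauliIndex n)) (hS : ∀ a ∈ S, a ≠ 0)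
    (hsum : ∀ a ∈ S, Summable fun t =>
      (A t).toReal * t.prob (pauliChannel (spikeRates a (δ a))) (E a)) :
    ∑ a ∈ S, (A.prob (pauliChannel (spikeRates a (δ a))) (E a) - A.prob Λ₀ (E a)) ≤
      S.card * α + T * (2 / α * (ε ^ 2 * 2 ^ n)) := by
  set B : ℝ := S.card * α + T * (2 / α * (ε ^ 2 * 2 ^ n)) with hB
  have hsub : ∀ a ∈ S, Summable fun t =>
      (A t).toReal * t.prob (pauliChannel (spikeRates a (δ a))) (E a) -
      (A t).toReal * t.prob Λ₀ (E a) := fun a ha =>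
    (hsum a ha).sub (summable_mul_prob_base A hΛ₀ _)
  calc ∑ a ∈ S, (A.prob (pauliChannel (spikeRates a (δ a))) (E a) - A.prob Λ₀ (E a))
      = ∑' t, ∑ a ∈ S, ((A t).toReal * t.prob (pauliChannel (spikeRates a (δ a))) (E a) -
          (A t).toReal * t.prob Λ₀ (E a)) := by
        rw [Summable.tsum_finsetSum hsub]
        refine Finset.sum_congr rfl fun a ha => ?_
        rw [(hsum a ha).tsum_sub (summable_mul_prob_base A hΛ₀ _)]
        rfl
    _ ≤ ∑' t, (A t).toReal * B := by
        refine (summable_sum hsub).tsum_le_tsum (fun t => ?_) ((summable_toReal A).mul_right B)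
        have h := PauliLearning.sum_prob_sub_prob_le hε hα hδ hΛ₀ E t S hS (fun _ => 1)
          (fun _ => zero_le_one)
        -- At the root all likelihood ratios are `1`, so each spike starts with potential `α`.
        have hpot : potential α 1 = α := by rw [potential]; ring
        rw [hpot, Finset.sum_const, nsmul_eq_mul, ← hB] at h
        simp only [one_mul] at h
        simp only [← mul_sub, ← Finset.mul_sum]
        exact mul_le_mul_of_nonneg_left h ENNReal.toReal_nonneg
    _ = B := by rw [tsum_mul_right, tsum_toReal, one_mul]

/-! ### From estimation to distinguishing. -/

/-- A spike of height `0` at any nonzero position; such a position exists because `n ≥ 1`. -/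
lemma exists_depolarizing (hn : 1 ≤ n) :
    ∃ Λ₀ : Op n → Op n, ∀ (r : Round n) s, r.outcomeProb Λ₀ s = baseProb r s := by
  have ha : (fun _ => (1, 0) : PauliIndex n) ≠ 0 := fun h => by
    simpa using congrArg Prod.fst (congrFun h ⟨0, hn⟩)
  refine ⟨pauliChannel (spikeRates (fun _ => (1, 0)) 0), fun r s => ?_⟩
  obtain ⟨t, ht, h⟩ := outcomeProb_spikeRates r ha (δ := 0) (by simp)
  have ht0 : t = 0 := by simpa using ht
  rw [h, ht0, zero_mul, add_zero, baseProb]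

/-- If a protocol solves eigenvalue estimation, then it detects each spike with good probability. -/
lemma Protocol.Solves.le_prob {ε p : ℝ} (hp : 0 < p) {T : ℕ} {A : Protocol n T}
    (hA : A.Solves ε p) {a : PauliIndex n} (ha : a ≠ 0) {δ : ℝ} (hδ : |δ| ≤ 1) :
    (Summable fun t => (A t).toReal * t.prob (pauliChannel (spikeRates a δ))
      {est | ∀ b, |est b - pauliEigenvalue (spikeRates a δ) b| < ε}) ∧
    p ≤ A.prob (pauliChannel (spikeRates a δ))
      {est | ∀ b, |est b - pauliEigenvalue (spikeRates a δ) b| < ε} := by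
  have h := hA _ (spikeRates_mem_stdSimplex ha hδ)
  refine ⟨?_, h⟩
  -- A non-summable `tsum` is `0`, which would contradict `0 < p ≤ A.prob`.
  by_contra hs
  rw [Protocol.prob, tsum_eq_zero_of_not_summable hs] at h
  linarith

lemma Protocol.Solves.bound (hn : 1 ≤ n) {ε p : ℝ} (hε0 : 0 < ε) (hε : ε ≤ 1) (hp : 0 < p)
    {T : ℕ} {A : Protocol n T} (hA : A.Solves ε p) {α : ℝ} (hα : 0 < α) :
    (4 ^ n - 1) * (2 * p - 1) ≤
      2 * ((4 ^ n - 1) * α + T * (2 / α * (ε ^ 2 * 2 ^ n))) := by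
  obtain ⟨Λ₀, hΛ₀⟩ := exists_depolarizing hn
  set S : Finset (PauliIndex n) := Finset.univ.erase 0 with hSdef
  have hS : ∀ a ∈ S, a ≠ 0 := fun a ha => Finset.ne_of_mem_erase ha
  have hcard : (S.card : ℝ) = 4 ^ n - 1 := by
    rw [hSdef, Finset.card_erase_of_mem (Finset.mem_univ _), Finset.card_univ, card_pauliIndex,
      Nat.cast_sub (Nat.one_le_pow _ _ (by norm_num))]
    simp
  have hside : ∀ δ : ℝ, |δ| = ε → ∑ a ∈ S, (p - A.prob Λ₀
      {est | ∀ b, |est b - pauliEigenvalue (spikeRates a δ) b| < ε}) ≤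
      (4 ^ n - 1) * α + T * (2 / α * (ε ^ 2 * 2 ^ n)) := by
    intro δ hδ
    have hδ1 : |δ| ≤ 1 := hδ.le.trans hε
    rw [← hcard]
    refine le_trans ?_ (Protocol.sum_prob_sub_prob_le hε hα (δ := fun _ => δ) (fun _ => hδ.le) hΛ₀
      (fun a => {est | ∀ b, |est b - pauliEigenvalue (spikeRates a δ) b| < ε}) A S hS
      fun a ha => (hA.le_prob hp (hS a ha) hδ1).1)
    exact Finset.sum_le_sum fun a ha => sub_le_sub_right (hA.le_prob hp (hS a ha) hδ1).2 _
  have h1 := hside ε (abs_of_pos hε0)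
  have h2 := hside (-ε) (by rw [abs_neg, abs_of_pos hε0])
  have h3 : ∑ a ∈ S, (2 * p - 1) ≤ ∑ a ∈ S, ((p - A.prob Λ₀
      {est | ∀ b, |est b - pauliEigenvalue (spikeRates a ε) b| < ε}) + (p - A.prob Λ₀
      {est | ∀ b, |est b - pauliEigenvalue (spikeRates a (-ε)) b| < ε})) := by
    refine Finset.sum_le_sum fun a ha => ?_
    have hdisj : Disjoint
        {est : PauliIndex n → ℝ | ∀ b, |est b - pauliEigenvalue (spikeRates a ε) b| < ε}
        {est : PauliIndex n → ℝ | ∀ b, |est b - pauliEigenvalue (spikeRates a (-ε)) b| < ε} := by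
      rw [Set.disjoint_left]
      -- At `b = a` the estimate would be strictly within `ε` of both `ε` and `-ε`.
      intro e he he'
      have h1 := (abs_lt.mp (he a)).1
      have h2 := (abs_lt.mp (he' a)).2
      rw [pauliEigenvalue_spikeRates (hS a ha)] at h1 h2
      linarith
    have := A.prob_add_prob_le_one hΛ₀ hdisj
    linarith
  rw [Finset.sum_add_distrib, Finset.sum_const, nsmul_eq_mul, hcard] at h3
  linarith

end PauliLearning

theorem theorem3p1 (p : ℝ) (hp : 1 / 2 < p) :
    ∃ c : ℝ, 0 < c ∧
      ∀ n : ℕ, 1 ≤ n → ∀ ε : ℝ, 0 < ε → ε ≤ 1 →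
        ∀ (T : ℕ) (A : PauliLearning.Protocol n T),
          PauliLearning.Protocol.Solves A ε p → c * (2 ^ n / ε ^ 2) ≤ (T : ℝ) := by
  have hg : 0 < 2 * p - 1 := by linarith
  -- With `g = 2p - 1`, the choice `α = g / 4` lets the `α` term absorb half of the left side. Then
  -- `4^n - 1 ≥ 4^n / 2` leaves `4^n g / 4 ≤ 16 T ε² 2^n / g`, whence the `64`.
  refine ⟨(2 * p - 1) ^ 2 / 64, by positivity, fun n hn ε hε0 hε T A hA => ?_⟩
  have h := hA.bound hn hε0 hε (by linarith) (α := (2 * p - 1) / 4) (by positivity)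
  set g := 2 * p - 1
  have h4 : (4 : ℝ) ^ n = 2 ^ n * 2 ^ n := by rw [← mul_pow]; norm_num
  have h2 : (2 : ℝ) ≤ 2 ^ n := by simpa using pow_le_pow_right₀ (one_le_two (α := ℝ)) hn
  have hN : (2 : ℝ) ^ n * 2 ^ n / 2 ≤ 4 ^ n - 1 := by rw [h4]; nlinarith
  have h5 : (4 ^ n - 1) * g / 2 ≤ 16 * (T * (ε ^ 2 * 2 ^ n)) / g := by
    have : 2 * (T * (2 / (g / 4) * (ε ^ 2 * 2 ^ n))) = 16 * (T * (ε ^ 2 * 2 ^ n)) / g := by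
      field_simp; ring
    linarith
  have h6 : (2 : ℝ) ^ n * (2 ^ n * g ^ 2) ≤ 2 ^ n * (64 * (T * ε ^ 2)) := by
    rw [le_div_iff₀ hg] at h5
    have := mul_le_mul_of_nonneg_right hN (sq_nonneg g)
    linarith
  have h7 := le_of_mul_le_mul_left h6 (by positivity)
  rw [div_mul_div_comm, div_le_iff₀ (by positivity)]
  linarith
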